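/- Let $A=\{a_1<\dots<a_{|A|}\}$ be a finite ordered alphabet with $|A|\ge 2$, $A^+$ the set of nonempty finite words over $A$, and let $\mathrm{string}$ be the enumeration of $A^+$ in lexicographic order (shorter words first, words of equal length in lexicographic order). For a sequence $\bar x=(x_n)_{n\ge 1}$ over $A$ let $\vec x(n)=x_1\cdots x_n$, let $p_n(\bar x)$ be the number of words of length $n$ that occur in $\bar x$ (as blocks of consecutive letters), and let $$H_{top}(\bar x)=\lim_{n\to\infty}\frac{\log_{|A|}p_n(\bar x)}{n}$$ be its topological entropy. A \emph{Chaitin computer} is a partial computable function $C$ from $A^+$ to $A^+$ (i.e. a partial recursive function on the natural numbers transported by $\mathrm{string}$) whose halting set contains no word together with a proper prefix of it. A Chaitin computer $U$ is \emph{universal} if for every Chaitin computer $C$ there is a constant $c_{U,C}>0$ such that for every $\vec x$ in the halting set of $C$ there is $\vec y\in A^+$ with $U(\vec y)=C(\vec x)$ and $|\vec y|\le|\vec x|+c_{U,C}$. Put $I_U(\vec x)=\min\{|\vec y| : \vec y \in A^+,\ U(\vec y)=\vec x\}$ ($+\infty$ if there is no such $\vec y$). The sequence $\bar x$ is \emph{algorithmically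 random} if for every universal Chaitin computer $U$ there is $c_U>0$ such that $I_U(\vec x(n))\ge n-c_U$ for all $n\ge 1$. The \emph{Champernowne sequence} over $A$ is the infinite concatenation of all the words of $A^+$ in the order given by $\mathrm{string}$, starting from the first word. (1) If $\bar x$ is an algorithmically random sequence over $A$, then every word of $A^+$ occurs in $\bar x$, $p_n(\bar x)=|A|^n$ for all $n\ge 1$, and the limit $H_{top}(\bar x)$ exists and equals $1$. (2) The converse fails: the Champernowne sequence over $A$ has topological entropy $1$ (the limit exists and equals $1$), but it is not algorithmically random. -/

import Mathlib

open Filter Topology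

namespace AlgRandom

/-! Throughout, the alphabet is a finite linearly ordered type `A` with at least two letters
(`Nontrivial A`); the order is the enumeration `a_1 < ... < a_|A|` of the letters. A sequence over
`A` is a function `x : ℕ → A`, whose first letter is `x 0`. -/

/-- The set `A^+` of nonempty finite words over `A`. -/
abbrev Word (A : Type*) : Type _ := {w : List A // w ≠ []}

/-- The length of a word. -/
def Word.length {A : Type*} (w : Word A) : ℕ := w.1.length

/-! ### Enumeration of words -/

/-- The position of a letter in the alphabet, counted from `0`. -/
noncomputable def letterIndex {A : Type*} [Fintype A] [LinearOrder A] (a : A) : Fin (Fintype.card A) :=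
  (monoEquivOfFin A rfl).symm a

/-- The bijective base-`|A|` value of a string of letters (empty string included), computed from
the starting value `m`. -/
noncomputable def valueFrom {A : Type*} [Fintype A] [LinearOrder A] (m : ℕ) (l : List A) : ℕ :=
  l.foldl (fun n a => n * Fintype.card A + letterIndex a + 1) m

theorem valueFrom_cons {A : Type*} [Fintype A] [LinearOrder A] (m : ℕ) (a : A) (l : List A) :
    valueFrom m (a :: l) = valueFrom (m * Fintype.card A + letterIndex a + 1) l := rfl

theorem valueFrom_concat {A : Type*} [Fintype A] [LinearOrder A] (m : ℕ) (a : A) (l : List A) :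
    valueFrom m (l ++ [a]) = valueFrom m l * Fintype.card A + letterIndex a + 1 := by
  simp [valueFrom]

theorem valueFrom_lt_of_lt {A : Type*} [Fintype A] [LinearOrder A] {l l' : List A}
    (h : l.length = l'.length) {m m' : ℕ} (hm : m < m') : valueFrom m l < valueFrom m' l' := by
  induction l generalizing l' m m' with
  | nil =>
    obtain rfl : l' = [] := List.length_eq_zero_iff.1 h.symm
    exact hm
  | cons a l ih =>
    cases l' with
    | nil => simp at h
    | cons b l' =>
      rw [valueFrom_cons, valueFrom_cons]
      apply ih (by simpa using h)
      have h1 := (letterIndex a).isLt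
      have h2 : (m + 1) * Fintype.card A ≤ m' * Fintype.card A := Nat.mul_le_mul_right _ hm
      rw [Nat.add_mul] at h2
      omega

theorem valueFrom_lt_of_lex {A : Type*} [Fintype A] [LinearOrder A] {l l' : List A}
    (h : List.Lex (· < ·) l l') (hl : l.length = l'.length) (m : ℕ) :
    valueFrom m l < valueFrom m l' := by
  induction h generalizing m with
  | nil => simp at hl
  | @cons a l l' h ih => exact ih (by simpa using hl) _
  | @rel a l b l' h =>
    rw [valueFrom_cons, valueFrom_cons]
    apply valueFrom_lt_of_lt (by simpa using hl)
    have : letterIndex a < letterIndex b := (monoEquivOfFin A rfl).symm.lt_iff_lt.2 h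
    have : (letterIndex a : ℕ) < letterIndex b := this
    omega

theorem valueFrom_lt_of_length_lt {A : Type*} [Fintype A] [LinearOrder A] (l l' : List A)
    (h : l.length < l'.length) : valueFrom 0 l < valueFrom 0 l' := by
  induction l using List.reverseRecOn generalizing l' with
  | nil =>
    rcases List.eq_nil_or_concat' l' with rfl | ⟨l', b, rfl⟩
    · simp at h
    · rw [valueFrom_concat]; simp [valueFrom]
  | append_singleton l a ih =>
    rcases List.eq_nil_or_concat' l' with rfl | ⟨l', b, rfl⟩
    · simp at h
    · rw [valueFrom_concat, valueFrom_concat]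
      have h0 := ih l' (by simpa using h)
      have h1 := (letterIndex a).isLt
      have h2 := Nat.mul_le_mul_right (Fintype.card A) (Nat.succ_le_of_lt h0)
      rw [Nat.succ_mul] at h2
      omega

/-- The index of a word in the enumeration of `A^+`, counted from `0`. -/
noncomputable def wordIndex {A : Type*} [Fintype A] [LinearOrder A] (w : Word A) : ℕ :=
  valueFrom 0 w.1 - 1

theorem valueFrom_pos {A : Type*} [Fintype A] [LinearOrder A] (w : Word A) :
    0 < valueFrom 0 w.1 := by
  have := valueFrom_lt_of_length_lt [] w.1 (by simpa using List.length_pos_iff.2 w.2)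
  exact lt_of_le_of_lt (Nat.zero_le _) this

/-- The enumeration is lexicographic: shorter words come first, and words of the same length are
ordered lexicographically. -/
theorem wordIndex_lt_of_shortlex {A : Type*} [Fintype A] [LinearOrder A] {v w : Word A}
    (h : List.Shortlex (· < ·) v.1 w.1) : wordIndex v < wordIndex w := by
  have hv := valueFrom_pos v
  have : valueFrom 0 v.1 < valueFrom 0 w.1 := by
    rcases List.shortlex_def.1 h with h | ⟨h, h'⟩
    · exact valueFrom_lt_of_length_lt _ _ h
    · exact valueFrom_lt_of_lex h' h 0
  unfold wordIndex
  omega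

theorem exists_valueFrom_eq {A : Type*} [Fintype A] [LinearOrder A] [Nontrivial A] (n : ℕ) :
    ∃ l : List A, valueFrom 0 l = n := by
  induction n using Nat.strong_induction_on with
  | _ n ih =>
    cases n with
    | zero => exact ⟨[], rfl⟩
    | succ m =>
      have hk : 0 < Fintype.card A := Fintype.card_pos
      obtain ⟨l, hl⟩ := ih (m / Fintype.card A) (Nat.lt_succ_of_le (Nat.div_le_self _ _))
      refine ⟨l ++ [monoEquivOfFin A rfl ⟨m % Fintype.card A, Nat.mod_lt _ hk⟩], ?_⟩
      rw [valueFrom_concat, hl]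
      simp only [letterIndex, OrderIso.symm_apply_apply]
      rw [Nat.div_add_mod']

theorem wordIndex_bijective {A : Type*} [Fintype A] [LinearOrder A] [Nontrivial A] :
    Function.Bijective (wordIndex : Word A → ℕ) := by
  constructor
  · intro v w h
    by_contra hne
    rcases trichotomous_of (List.Shortlex ((· < ·) : A → A → Prop)) v.1 w.1 with h' | h' | h'
    · exact absurd h (wordIndex_lt_of_shortlex h').ne
    · exact hne (Subtype.ext h')
    · exact absurd h.symm (wordIndex_lt_of_shortlex h').ne
  · intro n
    obtain ⟨l, hl⟩ := exists_valueFrom_eq (A := A) (n + 1)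
    refine ⟨⟨l, ?_⟩, ?_⟩
    · rintro rfl
      simp [valueFrom] at hl
    · simp [wordIndex, hl]

/-- The enumeration `string` of `A^+` in lexicographic order: `string 0` is the first word. -/
noncomputable def string (A : Type*) [Fintype A] [LinearOrder A] [Nontrivial A] : ℕ ≃ Word A :=
  (Equiv.ofBijective wordIndex wordIndex_bijective).symm

/-! ### Factors and topological entropy -/

/-- `w` occurs in the sequence `x` at position `n`. -/
def OccursAt {A : Type*} (w : Word A) (x : ℕ → A) (n : ℕ) : Prop :=
  ∀ (i : ℕ) (hi : i < w.1.length), x (n + i) = w.1[i]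

/-- `w` is a factor of the sequence `x`. -/
def IsFactor {A : Type*} (w : Word A) (x : ℕ → A) : Prop :=
  ∃ n, OccursAt w x n

/-- The language of length `n` of the sequence `x`. -/
def language {A : Type*} (x : ℕ → A) (n : ℕ) : Set (Word A) :=
  {w | w.length = n ∧ IsFactor w x}

/-- The combinatorial information function `p_n(x)`. -/
noncomputable def complexity {A : Type*} (x : ℕ → A) (n : ℕ) : ℕ :=
  (language x n).ncard

/-- The topological entropy of `x` exists and equals `h`, that is,
`log_|A| (p_n(x)) / n` converges to `h`. -/
def HasTopologicalEntropy {A : Type*} [Fintype A] (x : ℕ → A) (h : ℝ) : Prop :=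
  Tendsto (fun n : ℕ => Real.logb (Fintype.card A) (complexity x n) / n) atTop (𝓝 h)

/-! ### Chaitin computers and algorithmic randomness -/

/-- `v` is a (proper) prefix of `w`. -/
def IsProperPrefix {A : Type*} (v w : Word A) : Prop :=
  ∃ z : Word A, w.1 = v.1 ++ z.1

/-- A set of words none of whose elements is a proper prefix of another one. -/
def PrefixFree {A : Type*} (S : Set (Word A)) : Prop :=
  ∀ v ∈ S, ∀ w ∈ S, ¬ IsProperPrefix v w

/-- Partial computable functions on words: partial recursive functions on `ℕ`, transported by the
enumeration `string`. -/
def PartialComputable {A : Type*} [Fintype A] [LinearOrder A] [Nontrivial A]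
    (C : Word A →. Word A) : Prop :=
  ∃ f : ℕ →. ℕ, Nat.Partrec f ∧ ∀ w, C w = (f ((string A).symm w)).map (string A)

/-- A partial computable function with prefix-free halting set. -/
def IsChaitinComputer {A : Type*} [Fintype A] [LinearOrder A] [Nontrivial A]
    (C : Word A →. Word A) : Prop :=
  PartialComputable C ∧ PrefixFree C.Dom

/-- A Chaitin computer that simulates every other one up to an additive constant in the length of
the input. -/
def IsUniversalChaitinComputer {A : Type*} [Fintype A] [LinearOrder A] [Nontrivial A]
    (U : Word A →. Word A) : Prop :=
  IsChaitinComputer U ∧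
    ∀ C : Word A →. Word A, IsChaitinComputer C →
      ∃ c : ℝ, 0 < c ∧ ∀ x ∈ C.Dom, ∃ y : Word A, U y = C x ∧ (y.length : ℝ) ≤ x.length + c

/-- The algorithmic information `I_U(x)`: the least length of an input on which `U` outputs `x`,
and `⊤` if there is none. -/
noncomputable def algInfo {A : Type*} (U : Word A →. Word A) (x : Word A) : ℕ∞ :=
  ⨅ (y : Word A) (_ : x ∈ U y), (y.length : ℕ∞)

/-- The prefix of length `n` of the sequence `x`. -/
def seqPrefix {A : Type*} (x : ℕ → A) (n : ℕ+) : Word A :=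
  ⟨(List.range n).map x, by simp⟩

/-- Algorithmically random sequences: for every universal Chaitin computer `U` there is a constant
`c` with `I_U(x(n)) ≥ n - c` for all `n`. The inequality is written without subtraction, and `c`
is taken in `ℕ`, since any real constant may be rounded up. -/
def IsRandom {A : Type*} [Fintype A] [LinearOrder A] [Nontrivial A] (x : ℕ → A) : Prop :=
  ∀ U : Word A →. Word A, IsUniversalChaitinComputer U →
    ∃ c : ℕ, 0 < c ∧ ∀ n : ℕ+, ((n : ℕ) : ℕ∞) ≤ algInfo U (seqPrefix x n) + c

/-! ### The Champernowne sequence -/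

/-- The concatenation of the first `n` words of `A^+` in lexicographic order. -/
noncomputable def champernownePrefix (A : Type*) [Fintype A] [LinearOrder A] [Nontrivial A]
    (n : ℕ) : List A :=
  (List.range n).flatMap (fun i => (string A i).1)

theorem le_length_champernownePrefix (A : Type*) [Fintype A] [LinearOrder A] [Nontrivial A]
    (n : ℕ) : n ≤ (champernownePrefix A n).length := by
  induction n with
  | zero => simp
  | succ n ih =>
    have h : 0 < (string A n).1.length := List.length_pos_iff.2 (string A n).2
    have h' : champernownePrefix A (n + 1) = champernownePrefix A n ++ (string A n).1 := by
      simp [champernownePrefix, List.range_succ]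
    rw [h', List.length_append]
    omega

/-- The Champernowne sequence: the infinite concatenation of all the words of `A^+` in
lexicographic order. Its letter at `n` is read off from the first `n + 1` words, which together
have more than `n` letters. -/
noncomputable def champernowne (A : Type*) [Fintype A] [LinearOrder A] [Nontrivial A] : ℕ → A :=
  fun n => (champernownePrefix A (n + 1))[n]'(le_length_champernownePrefix A (n + 1))

end AlgRandom

namespace AlgRandom

/-! A random sequence cannot be compressed by any computable prefix code
(`IsRandom.exists_le_length_add`): reading the code is a Chaitin computer, and a universal computer
simulates it at constant cost. As randomness quantifies over universal computers, it would be
vacuous without one, so `exists_isUniversalChaitinComputer` is indispensable.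

Suppose that `w` does not occur in a random `x`. The blocks of length `|w|` take `p < |A|^|w|`
values, so the blocks of length `n = |w| k` take at most `p^k` values, which for large `k` is at
most `|A|^(n - 2)`. Coding each block by `n - 2` letters and a marker saves one letter per block,
and enough blocks beat any constant. Once every word occurs, `p_n = |A|^n` and the entropy is `1`.

The Champernowne sequence contains every word by construction, but it is computable: its prefix of
length `2(k + 1)` is described by the unary code of `k`, which has only `k + 1` letters. -/

/-- A coding of the letters by their positions. -/
noncomputable abbrev alphabetPrimcodable (A : Type*) [Fintype A] [LinearOrder A] : Primcodable A :=
  Primcodable.ofEquiv (Fin (Fintype.card A)) (monoEquivOfFin A rfl).symm.toEquiv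

attribute [local instance] alphabetPrimcodable

/-! ### Computability of the enumeration of words -/

section Coding

variable {A : Type*} [Fintype A] [LinearOrder A]

theorem primrecPred_list_ne_nil {α : Type*} [Primcodable α] :
    PrimrecPred (fun l : List α => l ≠ []) :=
  (Primrec.eq.comp Primrec.list_length (Primrec.const 0)).not.of_eq fun l => by simp

/-- The coding of words inherited from lists of letters. -/
noncomputable abbrev wordPrimcodable (A : Type*) [Fintype A] [LinearOrder A] : Primcodable (Word A) :=
  Primcodable.subtype primrecPred_list_ne_nil

attribute [local instance] wordPrimcodable

theorem primrec_word_val : Primrec (Subtype.val : Word A → List A) :=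
  Primrec.subtype_val

theorem primrec_word_mk {α : Type*} [Primcodable α] {f : α → List A} (h : ∀ a, f a ≠ [])
    (hf : Primrec f) : Primrec (fun a => (⟨f a, h a⟩ : Word A)) :=
  Primrec.subtype_mk hf

theorem primrec_letterIndex : Primrec (fun a : A => (letterIndex a : ℕ)) := by
  have : Primrec (letterIndex : A → Fin (Fintype.card A)) := Primrec.dom_finite _
  exact Primrec.fin_val.comp this

theorem primrec_valueFrom : Primrec (valueFrom 0 : List A → ℕ) :=
  Primrec.list_foldl Primrec.id (Primrec.const 0)
    (Primrec.succ.comp (Primrec.nat_add.comp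
      (Primrec.nat_mul.comp (Primrec.fst.comp Primrec.snd) (Primrec.const _))
      (primrec_letterIndex.comp (Primrec.snd.comp Primrec.snd)))).to₂

theorem primrec_wordIndex : Primrec (wordIndex : Word A → ℕ) :=
  Primrec.pred.comp (primrec_valueFrom.comp primrec_word_val)

variable [Nontrivial A]

/-- The letter at a given position, read cyclically. -/
noncomputable def letterMod (A : Type*) [Fintype A] [LinearOrder A] [Nontrivial A] (n : ℕ) : A :=
  monoEquivOfFin A rfl ⟨n % Fintype.card A, Nat.mod_lt _ Fintype.card_pos⟩

theorem letterIndex_letterMod (n : ℕ) :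
    (letterIndex (letterMod A n) : ℕ) = n % Fintype.card A := by
  simp [letterIndex, letterMod]

theorem primrec_letterMod : Primrec (letterMod A) := by
  have h : Primrec (fun i : Fin (Fintype.card A) => monoEquivOfFin A rfl i) := Primrec.dom_finite _
  refine h.comp (Primrec.fin_val_iff.1 ?_)
  exact Primrec.nat_mod.comp Primrec.id (Primrec.const _)

/-- The list of letters with a given bijective base-`|A|` value. -/
noncomputable def listOfValue (A : Type*) [Fintype A] [LinearOrder A] [Nontrivial A] : ℕ → List A
  | 0 => []
  | n + 1 =>
    have : n / Fintype.card A < n + 1 := Nat.lt_succ_of_le (Nat.div_le_self _ _)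
    listOfValue A (n / Fintype.card A) ++ [letterMod A n]

theorem valueFrom_listOfValue (n : ℕ) : valueFrom 0 (listOfValue A n) = n := by
  induction n using Nat.strong_induction_on with
  | _ n ih =>
    cases n with
    | zero => simp [listOfValue, valueFrom]
    | succ m =>
      rw [listOfValue, valueFrom_concat, ih _ (Nat.lt_succ_of_le (Nat.div_le_self _ _)),
        letterIndex_letterMod, Nat.div_add_mod']

theorem primrec_listOfValue : Primrec (listOfValue A) := by
  have key : Primrec₂ (fun (_ : Unit) n => listOfValue A n) := by
    -- Course-of-values recursion: `L` lists the values at all smaller arguments, so its length is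
    -- the current argument.
    refine Primrec.nat_strong_rec (g := fun _ L => if L.length = 0 then some []
      else (L[(L.length - 1) / Fintype.card A]?).map (· ++ [letterMod A (L.length - 1)]))
      (fun _ n => listOfValue A n) ?_ ?_
    · have hl : Primrec (fun p : Unit × List (List A) => p.2.length) :=
        Primrec.list_length.comp Primrec.snd
      have hp : Primrec (fun p : Unit × List (List A) => p.2.length - 1) := Primrec.pred.comp hl
      refine Primrec.ite (Primrec.eq.comp hl (Primrec.const 0)) (Primrec.const _) ?_
      refine Primrec.option_map (Primrec.list_getElem?.comp Primrec.snd
        (Primrec.nat_div.comp hp (Primrec.const _))) ?_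
      exact Primrec.list_append.comp Primrec.snd
        (Primrec.list_cons.comp (primrec_letterMod.comp (hp.comp Primrec.fst)) (Primrec.const []))
    · intro _ n
      cases n with
      | zero => simp [listOfValue]
      | succ m =>
        have : m / Fintype.card A < m + 1 := Nat.lt_succ_of_le (Nat.div_le_self _ _)
        simp [listOfValue, this]
  exact key.comp (Primrec.const ()) Primrec.id

theorem listOfValue_succ_ne_nil (n : ℕ) : listOfValue A (n + 1) ≠ [] := by
  simp [listOfValue]

theorem string_eq_listOfValue (n : ℕ) :
    string A n = ⟨listOfValue A (n + 1), listOfValue_succ_ne_nil n⟩ := by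
  rw [string, Equiv.symm_apply_eq]
  simp [wordIndex, valueFrom_listOfValue]

theorem primrec_string : Primrec (string A) :=
  (primrec_word_mk listOfValue_succ_ne_nil (primrec_listOfValue.comp Primrec.succ)).of_eq
    fun n => (string_eq_listOfValue n).symm

theorem primrec_string_symm : Primrec (string A).symm := primrec_wordIndex

theorem PartialComputable.of_partrec {C : Word A →. Word A} (h : Partrec C) :
    PartialComputable C := by
  refine ⟨fun n => (C (string A n)).map (string A).symm, ?_, fun w => ?_⟩
  · exact Partrec.nat_iff.1 ((h.comp primrec_string.to_comp).map
      (primrec_string_symm.to_comp.comp Computable.snd).to₂)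
  · simp [Part.map_map, Part.map_id']

end Coding

attribute [local instance] wordPrimcodable

/-- A partial function transported along a computable injection of its arguments. -/
theorem exists_partrec_extend {α β γ : Type*} [Primcodable α] [Primcodable β] [Primcodable γ]
    {e : α → β} (he : Computable e) (hinj : Function.Injective e) {g : α →. γ} (hg : Partrec g) :
    ∃ C : β →. γ, Partrec C ∧ (∀ a, C (e a) = g a) ∧ ∀ b ∈ C.Dom, ∃ a, e a = b ∧ (g a).Dom := by
  classical
  -- The inverse of `e` is found by unbounded search. Outside the range of `e` the search diverges,
  -- so the domain does not grow.
  let inv : β → ℕ → Option α := fun b n =>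
    (Encodable.decode (α := α) n).bind fun a => if e a = b then some a else none
  have hinv : Computable₂ inv := by
    refine Computable.option_bind (Computable.decode.comp Computable.snd) ?_
    have hd : Computable (fun p : (β × ℕ) × α => decide (e p.2 = p.1.1)) :=
      (Primrec.eq (α := β)).decide.to_comp.comp (he.comp Computable.snd)
        (Computable.fst.comp Computable.fst)
    exact (Computable.cond hd (Computable.option_some.comp Computable.snd)
      (Computable.const none)).of_eq fun p => by by_cases h : e p.2 = p.1.1 <;> simp [h]
  have hspec : ∀ b a, a ∈ Nat.rfindOpt (inv b) → e a = b := by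
    intro b a h
    obtain ⟨n, hn⟩ := Nat.rfindOpt_spec h
    simp only [inv, Option.mem_def, Option.bind_eq_some_iff] at hn
    obtain ⟨a', -, h'⟩ := hn
    split_ifs at h' with h2
    · cases h'
      exact h2
  have hval : ∀ a, Nat.rfindOpt (inv (e a)) = Part.some a := by
    intro a
    have hd : (Nat.rfindOpt (inv (e a))).Dom :=
      Nat.rfindOpt_dom.2 ⟨Encodable.encode a, a, by simp [inv]⟩
    have := hspec _ _ (Part.get_mem hd)
    exact (Part.some_get hd).symm.trans (congrArg Part.some (hinj this))
  refine ⟨fun b => (Nat.rfindOpt (inv b)).bind g,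
    (Partrec.rfindOpt hinv).bind (hg.comp Computable.snd).to₂, fun a => ?_, fun b hb => ?_⟩
  · exact (congrArg (Part.bind · g) (hval a)).trans (Part.bind_some _ _)
  · obtain ⟨c, hc⟩ := Part.dom_iff_mem.1 hb
    obtain ⟨a, ha, hc⟩ := Part.mem_bind_iff.1 hc
    exact ⟨a, hspec _ _ ha, Part.dom_iff_mem.2 ⟨c, hc⟩⟩

/-! ### Prefix codes -/

section PrefixCode

variable {A : Type*}

/-- A family of words none of which is a prefix of another one. -/
def IsPrefixCode {α : Type*} (e : α → Word A) : Prop :=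
  ∀ s t, (e s).1 <+: (e t).1 → s = t

theorem IsPrefixCode.injective {α : Type*} {e : α → Word A} (h : IsPrefixCode e) :
    Function.Injective e := fun s t hst => h s t (by rw [hst])

theorem IsProperPrefix.isPrefix {v w : Word A} (h : IsProperPrefix v w) : v.1 <+: w.1 :=
  let ⟨z, hz⟩ := h
  ⟨z.1, hz.symm⟩

theorem IsProperPrefix.ne {v w : Word A} (h : IsProperPrefix v w) : v ≠ w := by
  rintro rfl
  obtain ⟨z, hz⟩ := h
  exact z.2 (by simpa using hz)

theorem isProperPrefix_of_isPrefix {v w : Word A} (h : v.1 <+: w.1) (hne : v ≠ w) :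
    IsProperPrefix v w := by
  obtain ⟨z, hz⟩ := h
  refine ⟨⟨z, ?_⟩, hz.symm⟩
  rintro rfl
  exact hne (Subtype.ext (by simpa using hz))

theorem primrecRel_isPrefix {α : Type*} [Primcodable α] : PrimrecRel (fun v w : List α => v <+: w) :=
  (Primrec.eq.comp (Primrec.list_take.comp (Primrec.list_length.comp Primrec.fst) Primrec.snd)
    Primrec.fst).of_eq fun _ =>
      eq_comm.trans List.prefix_iff_eq_take.symm

end PrefixCode

/-! ### A universal Chaitin computer and incompressibility -/

section Universal

open Nat.Partrec (Code)

variable {A : Type*} [Fintype A] [LinearOrder A] [Nontrivial A]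

/-- Reading a prefix code gives a Chaitin computer. -/
theorem exists_isChaitinComputer {α : Type*} [Primcodable α] {e : α → Word A}
    (he : Computable e) (hpre : IsPrefixCode e) {g : α → Word A} (hg : Computable g) :
    ∃ C : Word A →. Word A, IsChaitinComputer C ∧ ∀ a, C (e a) = Part.some (g a) := by
  obtain ⟨C, hC, hval, hdom⟩ := exists_partrec_extend he hpre.injective hg.partrec
  refine ⟨C, ⟨PartialComputable.of_partrec hC, ?_⟩, fun a => hval a⟩
  intro v hv w hw h
  obtain ⟨s, rfl, -⟩ := hdom v hv
  obtain ⟨t, rfl, -⟩ := hdom w hw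
  exact h.ne (congrArg e (hpre s t h.isPrefix))

/-- Two indices belong to different words one of which is a prefix of the other. -/
def Conflict (A : Type*) [Fintype A] [LinearOrder A] [Nontrivial A] (m n : ℕ) : Prop :=
  m ≠ n ∧ ((string A m).1 <+: (string A n).1 ∨ (string A n).1 <+: (string A m).1)

theorem Conflict.symm {m n : ℕ} (h : Conflict A m n) : Conflict A n m :=
  ⟨h.1.symm, h.2.symm⟩

theorem primrecRel_conflict : PrimrecRel (Conflict A) := by
  have h : Primrec (fun n => (string A n).1) := primrec_word_val.comp primrec_string
  exact (Primrec.eq.comp Primrec.fst Primrec.snd).not.and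
    ((primrecRel_isPrefix.comp (h.comp Primrec.fst) (h.comp Primrec.snd)).or
      (primrecRel_isPrefix.comp (h.comp Primrec.snd) (h.comp Primrec.fst)))

/-- The index `n` conflicts with no index on which the code `c` halts within `k` steps. -/
def Admissible (A : Type*) [Fintype A] [LinearOrder A] [Nontrivial A] (k : ℕ) (c : Code) (n : ℕ) :
    Prop :=
  ∀ m < k, (Code.evaln k c m).isSome → ¬ Conflict A m n

theorem primrecPred_admissible :
    PrimrecPred (fun p : (ℕ × Code) × ℕ => Admissible A p.1.1 p.1.2 p.2) := by
  have h1 : PrimrecRel (fun (m : ℕ) (p : (ℕ × Code) × ℕ) =>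
      ¬ ((Code.evaln p.1.1 p.1.2 m).isSome = true ∧ Conflict A m p.2)) := by
    refine PrimrecPred.not (PrimrecPred.and ?_ ?_)
    · refine Primrec.eq.comp (Primrec.option_isSome.comp (Code.primrec_evaln.comp
        (Primrec.pair (Primrec.fst.comp Primrec.snd) Primrec.fst))) (Primrec.const true)
    · exact primrecRel_conflict.comp Primrec.fst (Primrec.snd.comp Primrec.snd)
  refine (h1.forall_mem_list.comp (Primrec.list_range.comp (Primrec.fst.comp Primrec.fst))
    Primrec.id).of_eq fun p => ?_
  simp [Admissible]

open Classical in
/-- The function computed by a code, cut down to a prefix-free set of words. -/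
noncomputable def prefixFreeEval (A : Type*) [Fintype A] [LinearOrder A] [Nontrivial A]
    (c : Code) (n : ℕ) : Part ℕ :=
  Nat.rfindOpt fun k => if Admissible A k c n then Code.evaln k c n else none

theorem partrec_prefixFreeEval : Partrec₂ (prefixFreeEval A) := by
  classical
  refine Partrec.rfindOpt (Primrec.to_comp ?_)
  have h : Primrec (fun p : (Code × ℕ) × ℕ => ((p.2, p.1.1), p.1.2)) :=
    Primrec.pair (Primrec.pair Primrec.snd (Primrec.fst.comp Primrec.fst))
      (Primrec.snd.comp Primrec.fst)
  exact Primrec.ite (primrecPred_admissible.comp h) (Code.primrec_evaln.comp h) (Primrec.const _)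

theorem exists_admissible_of_dom {c : Code} {n : ℕ} (h : (prefixFreeEval A c n).Dom) :
    ∃ k, Admissible A k c n ∧ (Code.evaln k c n).isSome := by
  obtain ⟨k, x, hx⟩ := Nat.rfindOpt_dom.1 h
  split_ifs at hx with hk
  · exact ⟨k, hk, Option.isSome_iff_exists.2 ⟨x, hx⟩⟩
  · simp at hx

theorem isSome_evaln_mono {k l : ℕ} (hkl : k ≤ l) {c : Code} {n : ℕ}
    (h : (Code.evaln k c n).isSome) : (Code.evaln l c n).isSome := by
  obtain ⟨x, hx⟩ := Option.isSome_iff_exists.1 h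
  exact Option.isSome_iff_exists.2 ⟨x, Code.evaln_mono hkl hx⟩

/-- Of two accepted inputs, the one accepted at the earlier stage still halts at the later stage,
and admissibility there excludes a conflict with it. -/
theorem not_conflict_of_dom {c : Code} {m n : ℕ} (hm : (prefixFreeEval A c m).Dom)
    (hn : (prefixFreeEval A c n).Dom) : ¬ Conflict A m n := by
  obtain ⟨k, hk, hk'⟩ := exists_admissible_of_dom hm
  obtain ⟨l, hl, hl'⟩ := exists_admissible_of_dom hn
  -- `evaln k` halts only on inputs below `k`, so testing only `m < k` in `Admissible` misses
  -- nothing.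
  have bound : ∀ {k n : ℕ}, (Code.evaln k c n).isSome → n < k := fun h =>
    let ⟨_, hx⟩ := Option.isSome_iff_exists.1 h
    Code.evaln_bound hx
  intro h
  rcases le_total k l with hkl | hkl
  · have := isSome_evaln_mono hkl hk'
    exact hl m (bound this) this h
  · have := isSome_evaln_mono hkl hl'
    exact hk n (bound this) this h.symm

/-- If the domain is already prefix-free, the filter never rejects, so every Chaitin computer
survives the cutting down unchanged. -/
theorem prefixFreeEval_eq_eval {c : Code}
    (h : ∀ m n, (c.eval m).Dom → (c.eval n).Dom → ¬ Conflict A m n) {n : ℕ}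
    (hn : (c.eval n).Dom) : prefixFreeEval A c n = c.eval n := by
  have hadm : ∀ k, Admissible A k c n := fun k m _ hm =>
    let ⟨_, hx⟩ := Option.isSome_iff_exists.1 hm
    h m n (Part.dom_iff_mem.2 ⟨_, Code.evaln_sound hx⟩) hn
  simp only [prefixFreeEval, hadm, if_true]
  exact (Code.eval_eq_rfindOpt c n).symm

/-- The unary code of a number: `n` copies of one letter followed by another one. -/
noncomputable def unary (A : Type*) [Fintype A] [LinearOrder A] [Nontrivial A] (n : ℕ) : List A :=
  List.replicate n (letterMod A 1) ++ [letterMod A 0]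

theorem letterMod_ne : letterMod A 1 ≠ letterMod A 0 := by
  intro h
  have := congrArg (fun a => (letterIndex a : ℕ)) h
  simp [letterIndex_letterMod, Nat.mod_eq_of_lt (Fintype.one_lt_card (α := A))] at this

theorem length_unary (n : ℕ) : (unary A n).length = n + 1 := by simp [unary]

/-- The first occurrence of the closing letter determines the number, so a unary header is
self-delimiting. -/
theorem unary_append_prefix {m n : ℕ} {v w : List A} (h : unary A m ++ v <+: unary A n ++ w) :
    m = n ∧ v <+: w := by
  induction m generalizing n with
  | zero =>
    cases n with
    | zero => simpa [unary] using h
    | succ n => simp [unary, List.replicate_succ, letterMod_ne.symm] at h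
  | succ m ih =>
    cases n with
    | zero => simp [unary, List.replicate_succ, letterMod_ne] at h
    | succ n =>
      have := ih (n := n) (by simpa [unary, List.replicate_succ] using h)
      simpa using this

theorem primrec_unary : Primrec (unary A) := by
  have h : Primrec (fun n : ℕ => (List.range n).map (fun _ => letterMod A 1)) :=
    Primrec.list_map Primrec.list_range (Primrec.const _).to₂
  refine (Primrec.list_append.comp h (Primrec.const [letterMod A 0])).of_eq fun n => ?_
  simp [unary]

/-- The computer `U` reads a program in unary and runs its cut-down version on the rest of the
input. Inputs comparable as prefixes share the header, hence the program, whose domain is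
prefix-free. -/
theorem exists_isUniversalChaitinComputer :
    ∃ U : Word A →. Word A, IsUniversalChaitinComputer U := by
  let e : Code × Word A → Word A := fun p =>
    ⟨unary A (Encodable.encode p.1) ++ p.2.1, by simp [unary]⟩
  have he : Primrec e := primrec_word_mk _ (Primrec.list_append.comp
    (primrec_unary.comp (Primrec.encode.comp Primrec.fst)) (primrec_word_val.comp Primrec.snd))
  have hpre : ∀ p q, (e p).1 <+: (e q).1 → p.1 = q.1 ∧ p.2.1 <+: q.2.1 := fun p q h =>
    (unary_append_prefix h).imp_left fun h' => Encodable.encode_injective h'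
  have hinj : Function.Injective e := fun p q h => by
    have h1 := hpre p q (by rw [h])
    have h2 := hpre q p (by rw [h])
    exact Prod.ext h1.1 (Subtype.ext (h1.2.eq_of_length_le h2.2.length_le))
  let g : Code × Word A →. Word A := fun p =>
    (prefixFreeEval A p.1 ((string A).symm p.2)).map (string A)
  have hg : Partrec g := (partrec_prefixFreeEval.comp Computable.fst
    (primrec_string_symm.to_comp.comp Computable.snd)).map
      (primrec_string.to_comp.comp Computable.snd).to₂
  obtain ⟨U, hU, hval, hdom⟩ := exists_partrec_extend he.to_comp hinj hg
  refine ⟨U, ⟨PartialComputable.of_partrec hU, ?_⟩, ?_⟩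
  · intro v hv w hw h
    obtain ⟨⟨c, v⟩, rfl, hcv⟩ := hdom v hv
    obtain ⟨⟨d, w⟩, rfl, hdw⟩ := hdom w hw
    obtain ⟨rfl, hvw⟩ : c = d ∧ v.1 <+: w.1 := hpre _ _ h.isPrefix
    refine not_conflict_of_dom (A := A) (c := c) (m := (string A).symm v) (n := (string A).symm w)
      hcv hdw ⟨fun heq => h.ne ?_, Or.inl (by simpa using hvw)⟩
    rw [(string A).symm.injective heq]
  · rintro C ⟨⟨f, hf, hC⟩, hfree⟩
    obtain ⟨c, rfl⟩ := Code.exists_code.1 hf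
    -- The constant is the length of the unary header.
    refine ⟨Encodable.encode c + 1, by positivity, fun x hx => ⟨e (c, x), ?_, ?_⟩⟩
    · rw [hval, hC]
      refine congrArg (Part.map (string A)) (prefixFreeEval_eq_eval ?_ ?_)
      · intro m n hm hn hmn
        have dom : ∀ m, (c.eval m).Dom → string A m ∈ C.Dom := fun m hm => by
          change (C (string A m)).Dom
          rw [hC]
          simpa using hm
        have hne : string A m ≠ string A n := fun h => hmn.1 ((string A).injective h)
        rcases hmn.2 with h | h
        · exact hfree _ (dom m hm) _ (dom n hn) (isProperPrefix_of_isPrefix h hne)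
        · exact hfree _ (dom n hn) _ (dom m hm) (isProperPrefix_of_isPrefix h hne.symm)
      · have : (C x).Dom := hx
        rw [hC] at this
        exact this
    · simp only [Word.length, e, List.length_append, length_unary]
      push_cast
      linarith

/-- A random sequence cannot be compressed by a computable prefix code. -/
theorem IsRandom.exists_le_length_add {x : ℕ → A} (hx : IsRandom x) {α : Type*} [Primcodable α]
    {e : α → Word A} (he : Computable e) (hpre : IsPrefixCode e) {g : α → Word A}
    (hg : Computable g) :
    ∃ c : ℕ, ∀ a (n : ℕ+), g a = seqPrefix x n → (n : ℕ) ≤ (e a).length + c := by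
  obtain ⟨U, hU⟩ := exists_isUniversalChaitinComputer (A := A)
  obtain ⟨c, -, hc⟩ := hx U hU
  obtain ⟨C, hC, hCe⟩ := exists_isChaitinComputer he hpre hg
  obtain ⟨d, -, hd⟩ := hU.2 C hC
  -- `d` is the cost of simulating `C` on `U`, and `c` is the randomness deficiency allowed for `U`.
  refine ⟨⌈d⌉₊ + c, fun a n han => ?_⟩
  have hdom : e a ∈ C.Dom := by
    change (C (e a)).Dom
    rw [hCe]
    trivial
  obtain ⟨y, hy, hlen⟩ := hd (e a) hdom
  have h1 : algInfo U (seqPrefix x n) ≤ (y.length : ℕ∞) :=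
    iInf₂_le y (by rw [hy, hCe, han]; exact Part.mem_some _)
  have h2 : ((n : ℕ) : ℕ∞) ≤ ((y.length + c : ℕ) : ℕ∞) := by
    push_cast
    exact (hc n).trans (by gcongr)
  have h3 : (n : ℕ) ≤ y.length + c := by exact_mod_cast h2
  have h4 : (y.length : ℝ) ≤ ((e a).length + ⌈d⌉₊ : ℕ) := by
    push_cast
    linarith [Nat.le_ceil d]
  have h5 : y.length ≤ (e a).length + ⌈d⌉₊ := by exact_mod_cast h4
  omega

end Universal

/-! ### Counting blocks of a sequence -/

section Blocks

variable {A : Type*}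

/-- The block of length `n` of `x` starting at position `i`. -/
def block (x : ℕ → A) (n i : ℕ) : Fin n → A := fun j => x (i + j)

theorem card_range_block_add_le [Finite A] (x : ℕ → A) (m n : ℕ) :
    Nat.card (Set.range (block x (m + n))) ≤
      Nat.card (Set.range (block x m)) * Nat.card (Set.range (block x n)) := by
  rw [← Nat.card_prod]
  refine Nat.card_le_card_of_injective
    (fun y => (⟨fun j => y.1 (Fin.castAdd n j), ?_⟩, ⟨fun j => y.1 (Fin.natAdd m j), ?_⟩)) ?_
  · obtain ⟨_, i, rfl⟩ := y
    exact ⟨i, by ext j; simp [block]⟩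
  · obtain ⟨_, i, rfl⟩ := y
    exact ⟨i + m, by ext j; simp [block, add_assoc]⟩
  · rintro ⟨y, hy⟩ ⟨z, hz⟩ h
    simp only [Prod.mk.injEq, Subtype.mk.injEq] at h
    refine Subtype.ext (funext fun j => ?_)
    induction j using Fin.addCases with
    | left j => exact congrFun h.1 j
    | right j => exact congrFun h.2 j

theorem card_range_block_mul_le [Finite A] (x : ℕ → A) (m k : ℕ) :
    Nat.card (Set.range (block x (m * k))) ≤ Nat.card (Set.range (block x m)) ^ k := by
  induction k with
  | zero =>
    rw [pow_zero]
    have : Subsingleton (Fin (m * 0) → A) := inferInstanceAs (Subsingleton (Fin 0 → A))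
    exact Finite.card_le_one_iff_subsingleton.2 inferInstance
  | succ k ih =>
    rw [Nat.mul_succ, pow_succ]
    exact (card_range_block_add_le x _ _).trans (Nat.mul_le_mul_right _ ih)

theorem flatMap_ofFn_block (x : ℕ → A) (n k : ℕ) :
    (List.range k).flatMap (fun i => List.ofFn (block x n (n * i))) =
      (List.range (n * k)).map x := by
  induction k with
  | zero => simp
  | succ k ih =>
    rw [List.range_succ, List.flatMap_append, ih, Nat.mul_succ, List.range_add]
    simp [block, List.ofFn_eq_map, ← List.map_coe_finRange_eq_range, Function.comp_def]

theorem card_range_block_lt [Fintype A] {x : ℕ → A} {w : Word A} (h : ¬ IsFactor w x) :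
    Nat.card (Set.range (block x w.length)) < Fintype.card A ^ w.length := by
  have hne : Set.range (block x w.length) ≠ Set.univ := fun huniv => by
    obtain ⟨n, hn⟩ := Set.range_eq_univ.1 huniv (fun j => w.1[j]'j.2)
    exact h ⟨n, fun i hi => congrFun hn ⟨i, hi⟩⟩
  have := Set.ncard_lt_card hne
  simpa [Nat.card_coe_set_eq] using this

/-- The ratio of occurring blocks to all blocks decays geometrically, so it falls below `|A|^(-2)`.
Of the two letters gained, one will pay for a marker and the other is the saving. -/
theorem exists_card_range_block_mul_le [Fintype A] [Nontrivial A] {x : ℕ → A} {w : Word A}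
    (h : ¬ IsFactor w x) :
    ∃ n, 2 ≤ n ∧ Nat.card (Set.range (block x n)) ≤ Fintype.card A ^ (n - 2) := by
  set p := Nat.card (Set.range (block x w.length)) with hp
  have hlt := card_range_block_lt h
  rw [← hp] at hlt
  have hA : 1 < Fintype.card A := Fintype.one_lt_card
  have hq : (0 : ℝ) < (Fintype.card A : ℝ) ^ w.length := by positivity
  obtain ⟨k, hk⟩ := exists_pow_lt_of_lt_one (x := 1 / (Fintype.card A : ℝ) ^ 2)
    (y := p / (Fintype.card A : ℝ) ^ w.length) (by positivity)
    ((div_lt_one hq).2 (by exact_mod_cast hlt))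
  rw [div_pow, div_lt_div_iff₀ (by positivity) (by positivity), one_mul] at hk
  have hk' : p ^ k * Fintype.card A ^ 2 < Fintype.card A ^ (w.length * k) := by
    rw [pow_mul]
    exact_mod_cast hk
  have hpos : 0 < p := by
    rw [hp]
    have : Nonempty (Set.range (block x w.length)) := ⟨⟨_, 0, rfl⟩⟩
    exact Nat.card_pos
  -- This keeps the natural subtraction `n - 2` from truncating.
  have h2 : 2 ≤ w.length * k := by
    refine ((Nat.pow_lt_pow_iff_right hA).1 (lt_of_le_of_lt ?_ hk')).le
    exact Nat.le_mul_of_pos_left _ (pow_pos hpos k)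
  refine ⟨w.length * k, h2, (card_range_block_mul_le x _ k).trans ?_⟩
  refine Nat.le_of_mul_le_mul_right ?_ (pow_pos (zero_lt_one.trans hA) 2)
  rw [← pow_add, Nat.sub_add_cancel h2]
  exact hk'.le

theorem complexity_eq_of_forall_isFactor [Fintype A] {x : ℕ → A}
    (h : ∀ w : Word A, IsFactor w x) {n : ℕ} (hn : 1 ≤ n) :
    complexity x n = Fintype.card A ^ n := by
  rw [complexity, ← card_vector n, ← Nat.card_eq_fintype_card, ← Nat.card_coe_set_eq]
  refine Nat.card_congr ⟨fun w => ⟨w.1.1, w.2.1⟩, fun v => ⟨⟨v.1, ?_⟩, v.2, h _⟩,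
    fun _ => rfl, fun _ => rfl⟩
  rintro h0
  have := v.2
  simp [h0] at this
  omega

theorem hasTopologicalEntropy_one_of_forall_isFactor [Fintype A] [Nontrivial A] {x : ℕ → A}
    (h : ∀ w : Word A, IsFactor w x) : HasTopologicalEntropy x 1 := by
  refine tendsto_const_nhds.congr' ?_
  filter_upwards [eventually_ge_atTop 1] with n hn
  have hA : (1 : ℝ) < Fintype.card A := by exact_mod_cast Fintype.one_lt_card
  have hn' : (n : ℝ) ≠ 0 := by positivity
  rw [complexity_eq_of_forall_isFactor h hn, Nat.cast_pow, Real.logb_pow,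
    Real.logb_self_eq_one hA, mul_one, div_self hn']

end Blocks

/-! ### Random sequences contain every word -/

section Random

variable {A : Type*} [Fintype A] [LinearOrder A] [Nontrivial A]

/-- A list of codewords of equal length, each preceded by one marker and the last one followed by
another marker. -/
noncomputable def framed {α : Type*} (code : α → List A) (l : List α) : Word A :=
  ⟨l.flatMap (fun s => letterMod A 1 :: code s) ++ [letterMod A 0], by simp⟩

/-- The markers tell whether another codeword follows, and the common length tells where it ends. -/
theorem isPrefixCode_framed {α : Type*} {code : α → List A} {n : ℕ}
    (hinj : Function.Injective code) (hlen : ∀ s, (code s).length = n) :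
    IsPrefixCode (framed code) := by
  intro l
  induction l with
  | nil =>
    rintro (_ | ⟨t, l'⟩) h
    · rfl
    · simp [framed, letterMod_ne.symm] at h
  | cons s l ih =>
    rintro (_ | ⟨t, l'⟩) h
    · simp [framed, letterMod_ne] at h
    · obtain ⟨z, hz⟩ := h
      simp only [framed, List.flatMap_cons, List.cons_append, List.append_assoc,
        List.cons.injEq, true_and] at hz
      obtain ⟨h1, h2⟩ := List.append_inj hz (by rw [hlen, hlen])
      rw [hinj h1, ih l' ⟨z, by simpa [framed] using h2⟩]

theorem length_framed {α : Type*} {code : α → List A} {n : ℕ}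
    (hlen : ∀ s, (code s).length = n) (l : List α) :
    (framed code l).length = l.length * (n + 1) + 1 := by
  simp [framed, Word.length, List.length_flatMap, hlen]

theorem primrec_framed {α : Type*} [Primcodable α] [Finite α] (code : α → List A) :
    Primrec (framed code) :=
  primrec_word_mk _ (Primrec.list_append.comp (Primrec.list_flatMap Primrec.id
    ((Primrec.dom_finite fun s => letterMod A 1 :: code s).comp Primrec.snd).to₂)
    (Primrec.const _))

/-- A list of letters as a word, the empty list being replaced by a one-letter word. -/
noncomputable def toWord (l : List A) : Word A :=
  ⟨if l = [] then [letterMod A 0] else l, by split_ifs with h <;> simp [h]⟩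

theorem primrec_toWord : Primrec (toWord : List A → Word A) :=
  primrec_word_mk _ (Primrec.ite (Primrec.eq.comp Primrec.id (Primrec.const []))
    (Primrec.const _) Primrec.id)

theorem IsRandom.isFactor {x : ℕ → A} (hx : IsRandom x) (w : Word A) : IsFactor w x := by
  by_contra hw
  obtain ⟨n, hn, hcard⟩ := exists_card_range_block_mul_le hw
  obtain ⟨M, ⟨φ⟩⟩ := Finite.exists_equiv_fin (Set.range (block x n))
  rw [Nat.card_congr φ, Nat.card_fin] at hcard
  obtain ⟨code⟩ : Nonempty (Fin M ↪ (Fin (n - 2) → A)) :=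
    Function.Embedding.nonempty_of_card_le (by simpa using hcard)
  have hlen : ∀ s, (List.ofFn (code s)).length = n - 2 := fun s => List.length_ofFn
  obtain ⟨c, hc⟩ := hx.exists_le_length_add
    (primrec_framed fun s => List.ofFn (code s)).to_comp
    (isPrefixCode_framed (List.ofFn_injective.comp code.injective) hlen)
    (g := fun l => toWord (l.flatMap fun s => List.ofFn (φ.symm s).1))
    (primrec_toWord.comp (Primrec.list_flatMap Primrec.id
      ((Primrec.dom_finite fun s => List.ofFn (φ.symm s).1).comp Primrec.snd).to₂)).to_comp
  -- With `c + 2` blocks the code has `(c + 2)(n - 1) + 1` letters; adding `c` still gives one less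
  -- than `n(c + 2)`.
  have key := hc ((List.range (c + 2)).map fun i => φ ⟨block x n (n * i), _, rfl⟩)
    ⟨n * (c + 2), by positivity⟩ ?_
  · rw [length_framed hlen, List.length_map, List.length_range, PNat.mk_coe] at key
    obtain ⟨m, rfl⟩ := Nat.exists_eq_add_of_le hn
    rw [Nat.add_sub_cancel_left] at key
    nlinarith
  · refine Subtype.ext ?_
    have h : (List.map (fun i => φ ⟨block x n (n * i), _, rfl⟩) (List.range (c + 2))).flatMap
        (fun s => List.ofFn (φ.symm s).1) = (List.range (n * (c + 2))).map x := by
      rw [← flatMap_ofFn_block, List.flatMap_map]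
      simp only [Equiv.symm_apply_apply]
    have hne : n ≠ 0 := by omega
    simp only [toWord, seqPrefix, h, PNat.mk_coe]
    simp [hne]

end Random

/-! ### The Champernowne sequence -/

section Champernowne

variable {A : Type*} [Fintype A] [LinearOrder A] [Nontrivial A]

theorem champernownePrefix_succ (n : ℕ) :
    champernownePrefix A (n + 1) = champernownePrefix A n ++ (string A n).1 := by
  simp [champernownePrefix, List.range_succ]

theorem champernownePrefix_isPrefix {m n : ℕ} (h : m ≤ n) :
    champernownePrefix A m <+: champernownePrefix A n := by
  induction n, h using Nat.le_induction with
  | base => exact List.prefix_rfl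
  | succ n _ ih =>
    rw [champernownePrefix_succ]
    exact ih.trans (List.prefix_append _ _)

theorem champernowne_eq_getElem {i n : ℕ} (h : i < (champernownePrefix A n).length) :
    champernowne A i = (champernownePrefix A n)[i] := by
  rcases le_total n (i + 1) with hn | hn
  · exact ((champernownePrefix_isPrefix hn).getElem h).symm
  · exact (champernownePrefix_isPrefix hn).getElem _

theorem isFactor_champernowne (w : Word A) : IsFactor w (champernowne A) := by
  obtain ⟨n, rfl⟩ := (string A).surjective w
  refine ⟨(champernownePrefix A n).length, fun i hi => ?_⟩
  rw [champernowne_eq_getElem (n := n + 1) (by rw [champernownePrefix_succ]; simpa using hi)]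
  simp [champernownePrefix_succ]

theorem seqPrefix_champernowne (n : ℕ+) :
    (seqPrefix (champernowne A) n).1 = (champernownePrefix A n).take n := by
  have h := le_length_champernownePrefix A n
  refine List.ext_getElem (by simp [seqPrefix, h]) fun i hi _ => ?_
  have hi' : i < n := by simpa [seqPrefix] using hi
  simp [seqPrefix, champernowne_eq_getElem (hi'.trans_le h)]

theorem primrec_champernownePrefix : Primrec (champernownePrefix A) :=
  Primrec.list_flatMap Primrec.list_range
    ((primrec_word_val.comp primrec_string).comp Primrec.snd).to₂

theorem not_isRandom_champernowne : ¬ IsRandom (champernowne A) := by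
  intro hx
  have hdouble : Primrec (fun k : ℕ => 2 * (k + 1)) :=
    Primrec.nat_mul.comp (Primrec.const 2) Primrec.succ
  obtain ⟨c, hc⟩ := hx.exists_le_length_add
    (e := fun k => (⟨unary A k, by simp [unary]⟩ : Word A))
    (primrec_word_mk (fun k => by simp [unary]) primrec_unary).to_comp
    (fun s t h => (unary_append_prefix (v := []) (w := []) (by simpa using h)).1)
    (g := fun k => seqPrefix (champernowne A) ⟨2 * (k + 1), by positivity⟩)
    (primrec_word_mk _ ((Primrec.list_take.comp hdouble
      (primrec_champernownePrefix.comp hdouble)).of_eq fun k =>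
        (seqPrefix_champernowne ⟨2 * (k + 1), by positivity⟩).symm)).to_comp
  -- At `k = c` the bound would read `2(c + 1) ≤ (c + 1) + c`.
  have := hc c _ rfl
  simp only [Word.length, length_unary, PNat.mk_coe] at this
  omega

end Champernowne

end AlgRandom

theorem mainTheorem4 (A : Type*) [Fintype A] [LinearOrder A] [Nontrivial A] :
    (∀ x : ℕ → A, AlgRandom.IsRandom x →
      (∀ w : AlgRandom.Word A, AlgRandom.IsFactor w x) ∧
      (∀ n : ℕ, 1 ≤ n → AlgRandom.complexity x n = Fintype.card A ^ n) ∧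
      AlgRandom.HasTopologicalEntropy x 1) ∧
    (AlgRandom.HasTopologicalEntropy (AlgRandom.champernowne A) 1 ∧
      ¬ AlgRandom.IsRandom (AlgRandom.champernowne A)) :=
  ⟨fun _ hx => ⟨hx.isFactor, fun _ => AlgRandom.complexity_eq_of_forall_isFactor hx.isFactor,
    AlgRandom.hasTopologicalEntropy_one_of_forall_isFactor hx.isFactor⟩,
    AlgRandom.hasTopologicalEntropy_one_of_forall_isFactor AlgRandom.isFactor_champernowne,
    AlgRandom.not_isRandom_champernowne⟩
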